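/- Let $G$ be a (Hausdorff) locally compact group with a fixed left Haar measure $dt$, and let $C_c(G)$ be the space of continuous complex functions on $G$ with compact support, with convolution $(f*g)(t)=\int_G f(s)g(s^{-1}t)\,ds$, the $L^1$-norm $\|f\|_{L^1(G)}=\int_G|f(t)|\,dt$, and $\varepsilon_G(f)=\int_G f(t)\,dt$. For a non-empty compact $K\subseteq G$ let $C_K(G)=\{f\in C_c(G):\operatorname{supp} f\subseteq K\}$. A unitary representation $\pi$ of $G$ on a complex Hilbert space $\mathfrak H$ is called norm-continuous if $t\mapsto \pi_t\xi$ is norm-continuous for every $\xi\in\mathfrak H$; put $\hat\pi(f)\xi=\int_G f(t)\,\pi_t\xi\,dt$ for $f\in C_c(G)$, $\xi\in\mathfrak H$. The group $G$ has property $(T)$ if every norm-continuous unitary representation $\pi$ of $G$ which has almost invariant unit vectors (for every compact $Q\subseteq G$ and $\epsilon>0$ there is a unit vector $\xi$ with $\|\pi_t\xi-\xi\|<\epsilon$ for all $t\in Q$) has a non-zero invariant vector. A linear map $\theta:C_c(G)\to\mathfrak H$ is called - $L^1$-bounded if there is $\kappa\ge 0$ with $\|\theta(f)\|\le\kappa\|f\|_{L^1(G)}$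 for all $f\in C_c(G)$; - locally bounded if for every non-empty compact $K\subseteq G$ there is $\kappa_K\ge 0$ with $\|\theta(f)\|\le\kappa_K\|f\|_{L^1(G)}$ for all $f\in C_K(G)$; - continuously locally bounded if there are $\kappa_K\ge 0$, one for each non-empty compact $K\subseteq G$, with $\|\theta(f)\|\le\kappa_K\|f\|_{L^1(G)}$ for all $f\in C_K(G)$, such that for every $\epsilon>0$ there is a neighbourhood $U_\epsilon$ of the identity of $G$ with $\kappa_K<\epsilon$ whenever $K\subseteq U_\epsilon$. Consider the relation $$\theta(f*g)=\hat\pi(f)\theta(g)+\varepsilon_G(g)\,\theta(f)\qquad(f,g\in C_c(G)).\tag{1}$$ (a) If $G$ has property $(T)$, then for every norm-continuous unitary representation $\pi$ of $G$ on a Hilbert space $\mathfrak H$, every continuously locally bounded linear map $\theta:C_c(G)\to\mathfrak H$ satisfying (1) is $L^1$-bounded. If $G$ has property $(T)$ and is second countable, then for every such $\pi$, every locally bounded linear map $\theta:C_c(G)\to\mathfrak H$ satisfying (1) is $L^1$-bounded. (b) Conversely, suppose that $G$ is $\sigma$-compact and that for every norm-continuous unitary representation $\pi$ of $G$ on a Hilbert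 space $\mathfrak H$, every continuously locally bounded linear map $\theta:C_c(G)\to\mathfrak H$ satisfying (1) is $L^1$-bounded. Then $G$ has property $(T)$. -/

import Mathlib

open MeasureTheory TopologicalSpace
open scoped CompactlySupported NNReal Topology Pointwise

universe u v

namespace PropertyTDerivation

section Representations

variable {G : Type u} [Group G] [TopologicalSpace G]

/-- Continuity of a unitary representation (called norm-continuity here): for every vector `ξ`,
the orbit map `t ↦ π t ξ` is continuous for the norm of the Hilbert space. -/
def NormContinuous {H : Type*} [NormedAddCommGroup H] [InnerProductSpace ℂ H]
    (π : G →* (H ≃ₗᵢ[ℂ] H)) : Prop :=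
  ∀ ξ : H, Continuous fun t : G => π t ξ

/-- `π` has almost invariant unit vectors. -/
def HasAlmostInvariantUnitVectors {H : Type*} [NormedAddCommGroup H] [InnerProductSpace ℂ H]
    (π : G →* (H ≃ₗᵢ[ℂ] H)) : Prop :=
  ∀ Q : Set G, IsCompact Q → ∀ ε : ℝ, 0 < ε →
    ∃ ξ : H, ‖ξ‖ = 1 ∧ ∀ t ∈ Q, ‖π t ξ - ξ‖ < ε

/-- `π` has a non-zero invariant vector. -/
def HasNonzeroInvariantVector {H : Type*} [NormedAddCommGroup H] [InnerProductSpace ℂ H]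
    (π : G →* (H ≃ₗᵢ[ℂ] H)) : Prop :=
  ∃ ξ : H, ξ ≠ 0 ∧ ∀ t : G, π t ξ = ξ

variable (G) in
/-- Kazhdan's property (T): every continuous unitary representation of `G` on a complex Hilbert
space that has almost invariant unit vectors has a non-zero invariant vector. The Hilbert spaces
range over a universe containing that of `G`, so every cyclic representation of `G` occurs up to
unitary equivalence. -/
def PropertyT : Prop :=
  ∀ (H : Type (max u v)) [NormedAddCommGroup H] [InnerProductSpace ℂ H] [CompleteSpace H]
    (π : G →* (H ≃ₗᵢ[ℂ] H)),
    NormContinuous π → HasAlmostInvariantUnitVectors π → HasNonzeroInvariantVector π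

end Representations

section Algebra

variable {G : Type u} [Group G] [TopologicalSpace G] [IsTopologicalGroup G]
  [MeasurableSpace G] [BorelSpace G]

/-- Convolution on `C_c(G)`: `(f * g)(t) = ∫ f(s) g(s⁻¹ t) ds`. -/
noncomputable def convol [T2Space G] (μ : Measure G) [IsFiniteMeasureOnCompacts μ]
    (f g : C_c(G, ℂ)) : C_c(G, ℂ) where
  toFun t := ∫ s, f s * g (s⁻¹ * t) ∂μ
  continuous_toFun := by
    rw [← continuousOn_univ]
    refine continuousOn_integral_of_compact_support (μ := μ)
      (f := fun t s => f s * g (s⁻¹ * t)) f.hasCompactSupport ?_ ?_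
    · refine Continuous.continuousOn ?_
      fun_prop
    · intro t s _ hs
      simp [image_eq_zero_of_notMem_tsupport hs]
  hasCompactSupport' := by
    refine HasCompactSupport.intro
      (f.hasCompactSupport.isCompact.mul g.hasCompactSupport.isCompact) ?_
    intro t ht
    have h0 : ∀ s, f s * g (s⁻¹ * t) = 0 := by
      intro s
      by_contra hne
      apply ht
      refine Set.mem_mul.2 ⟨s, ?_, s⁻¹ * t, ?_, by group⟩
      · exact subset_tsupport _ (left_ne_zero_of_mul hne)
      · exact subset_tsupport _ (right_ne_zero_of_mul hne)
    simp [h0]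

/-- The character `ε_G` of `C_c(G)`: integration over `G`. -/
noncomputable def augmentation (μ : Measure G) (f : C_c(G, ℂ)) : ℂ :=
  ∫ t, f t ∂μ

/-- The `L¹`-norm on `C_c(G)`. -/
noncomputable def normL1 (μ : Measure G) (f : C_c(G, ℂ)) : ℝ :=
  ∫ t, ‖f t‖ ∂μ

variable {H : Type*} [NormedAddCommGroup H] [InnerProductSpace ℂ H]

/-- The integrated form `π̂` of `π`: `π̂(f) ξ = ∫ f(t) π(t) ξ dt`. -/
noncomputable def integratedForm (μ : Measure G) (π : G →* (H ≃ₗᵢ[ℂ] H)) (f : C_c(G, ℂ)) (ξ : H) :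
    H :=
  ∫ t, f t • π t ξ ∂μ

/-- The derivation relation `θ(f * g) = π̂(f) θ(g) + θ(f) ε_G(g)`. -/
def IsDerivation [T2Space G] (μ : Measure G) [IsFiniteMeasureOnCompacts μ]
    (π : G →* (H ≃ₗᵢ[ℂ] H)) (θ : C_c(G, ℂ) →ₗ[ℂ] H) : Prop :=
  ∀ f g : C_c(G, ℂ),
    θ (convol μ f g) = integratedForm μ π f (θ g) + augmentation μ g • θ f

/-- `θ` is bounded for the `L¹`-norm. -/
def L1Bounded (μ : Measure G) (θ : C_c(G, ℂ) →ₗ[ℂ] H) : Prop :=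
  ∃ κ : ℝ≥0, ∀ f : C_c(G, ℂ), ‖θ f‖ ≤ κ * normL1 μ f

/-- `θ` is locally bounded: its restriction to `C_K(G)` is `L¹`-bounded for every non-empty
compact `K`. -/
def LocallyBounded (μ : Measure G) (θ : C_c(G, ℂ) →ₗ[ℂ] H) : Prop :=
  ∀ K : NonemptyCompacts G, ∃ κ : ℝ≥0, ∀ f : C_c(G, ℂ), tsupport f ⊆ (K : Set G) →
    ‖θ f‖ ≤ κ * normL1 μ f

/-- `θ` is continuously locally bounded: there are bounds `κ K` of the restrictions of `θ` to
`C_K(G)` that become arbitrarily small as `K` shrinks to the identity. -/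
def ContinuouslyLocallyBounded (μ : Measure G) (θ : C_c(G, ℂ) →ₗ[ℂ] H) : Prop :=
  ∃ κ : NonemptyCompacts G → ℝ≥0,
    (∀ (K : NonemptyCompacts G) (f : C_c(G, ℂ)), tsupport f ⊆ (K : Set G) →
      ‖θ f‖ ≤ κ K * normL1 μ f) ∧
    ∀ ε : ℝ, 0 < ε → ∃ U ∈ 𝓝 (1 : G), ∀ K : NonemptyCompacts G, (K : Set G) ⊆ U → (κ K : ℝ) < ε

end Algebra

end PropertyTDerivation

open PropertyTDerivation

/-!
Property (T) is first expressed through `1`-cocycles, that is, maps `b : G → H` with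
`b (s t) = b s + π s (b t)`: locally bounded derivations of `C_c(G)` are the same thing as
continuous cocycles, and `L¹`-boundedness of the derivation is boundedness of the cocycle.

*From derivations to cocycles.* Let `θ` be a locally bounded derivation. Since `θ` is continuous for
the supremum norm on functions supported in a fixed compact set, it commutes with the integral
`f * g = ∫ f(s) (s · g) ds`, where `s · g` is the left translate (`LocallyBounded.map_convol`).
Comparison with the derivation relation, for `g` of integral `1`, gives `θ f = ∫ f(s) b(s) ds` with
`b s = θ (s · g) - π s (θ g)`. As `b` is continuous, this formula determines it, so that `g` may be
replaced by its translates, and this is the cocycle identity (`LocallyBounded.exists_cocycle`). No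
continuity in the local bounds and no countability of `G` is needed. Conversely the integral of a
continuous cocycle is a continuously locally bounded derivation (`isDerivation_integrateAgainst`,
`continuouslyLocallyBounded_integrateAgainst`), and testing on bump functions recovers the
supremum of `‖b‖` from the `L¹`-bound (`norm_le_of_norm_integral_smul_le`).

*Property (T) implies that cocycles are bounded* (`PropertyT.isBounded_cocycle`). The affine action
`x ↦ π t x + b t` on `H` preserves the Gaussian kernels `exp (-‖x - y‖² / (n + 1)²)`, which are
positive semidefinite by the Schur product theorem. On the Hilbert space they generate for all `n`
together, `G` acts unitarily with almost invariant unit vectors. If `b` were unbounded, the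
kernel vectors would tend weakly to `0` along some sequence in `G`, and there would be no non-zero
invariant vector.

*The converse for `σ`-compact groups* (`propertyT_of_isBounded_cocycle`). Given unit vectors `ξ n`
which are invariant up to `2⁻ⁿ / (n + 1)` on the `n`-th set of a compact exhaustion, the
vectors `(n + 1) (π t (ξ n) - ξ n)` are the components of a continuous cocycle in a countable
multiple of `π`. If it is bounded, the orbit of `ξ n` stays close to `ξ n` for large `n`,
and the vector of minimal norm in the closed convex hull of the orbit is non-zero and
invariant (`hasNonzeroInvariantVector_of_norm_sub_le`).
-/

namespace PropertyTDerivation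

/-! ### The Gaussian kernel -/

section GaussianKernel

open scoped ComplexOrder Matrix

lemma posSemidef_of_eq {X : Type*} {M N : Matrix X X ℂ} (hM : M.PosSemidef) (h : N = M) :
    N.PosSemidef := h ▸ hM

/-- Positive semidefiniteness is preserved by entrywise limits. -/
lemma posSemidef_of_tendsto {X : Type*} {M : ℕ → Matrix X X ℂ} {L : Matrix X X ℂ}
    (hM : ∀ n, (M n).PosSemidef)
    (hL : ∀ x y, Filter.Tendsto (fun n => M n x y) Filter.atTop (𝓝 (L x y))) :
    L.PosSemidef := by
  refine ⟨?_, fun c => ?_⟩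
  · ext x y
    refine tendsto_nhds_unique (f := fun n => star (M n y x)) (l := Filter.atTop)
      ((hL y x).star) ?_
    simpa only [(hM _).isHermitian.apply] using hL x y
  · refine ge_of_tendsto' (f := fun n => c.sum fun i xi => c.sum fun j xj =>
      star xi * M n i j * xj) (x := Filter.atTop) ?_ fun n => (hM n).2 c
    refine tendsto_finsetSum _ fun i _ => tendsto_finsetSum _ fun j _ => ?_
    exact ((hL i j).const_mul _).mul_const _

/-- Gram matrices, of any size, are positive semidefinite. -/
lemma posSemidef_gram_of_family {X E : Type*} [NormedAddCommGroup E] [InnerProductSpace ℂ E]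
    (v : X → E) : (Matrix.of fun x y => inner ℂ (v x) (v y) : Matrix X X ℂ).PosSemidef := by
  refine ⟨by ext; simp, fun c => ?_⟩
  have : (c.sum fun i xi => c.sum fun j xj =>
      star xi * (Matrix.of fun x y => inner ℂ (v x) (v y) : Matrix X X ℂ) i j * xj)
      = inner ℂ (c.sum fun i xi => xi • v i) (c.sum fun i xi => xi • v i) := by
    simp only [Finsupp.sum, sum_inner, inner_sum, inner_smul_left, inner_smul_right,
      Finset.mul_sum]
    rw [Finset.sum_comm]
    refine Finset.sum_congr rfl fun i _ => Finset.sum_congr rfl fun j _ => ?_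
    simp only [Matrix.of_apply, Complex.star_def]
    ring
  rw [this, inner_self_eq_norm_sq_to_K]
  rw [← RCLike.ofReal_pow]
  exact Complex.zero_le_real.2 (sq_nonneg _)

lemma posSemidef_entrywise_pow {X : Type*} {M : Matrix X X ℂ} (hM : M.PosSemidef) (k : ℕ) :
    (Matrix.of fun x y => M x y ^ k : Matrix X X ℂ).PosSemidef := by
  induction k with
  | zero => simpa using posSemidef_gram_of_family fun _ : X => (1 : ℂ)
  | succ k ih =>
    have h : (Matrix.of fun x y => M x y ^ (k + 1) : Matrix X X ℂ)
        = (Matrix.of fun x y => M x y ^ k : Matrix X X ℂ) ⊙ M := by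
      ext; simp [pow_succ]
    rw [h]
    exact ih.hadamard hM

/-- The entrywise exponential of a positive semidefinite matrix is positive semidefinite: it is the
limit of nonnegative combinations of entrywise powers. -/
lemma posSemidef_entrywise_exp {X : Type*} {M : Matrix X X ℂ} (hM : M.PosSemidef) :
    (Matrix.of fun x y => Complex.exp (M x y) : Matrix X X ℂ).PosSemidef := by
  refine posSemidef_of_tendsto (M := fun n => ∑ k ∈ Finset.range n,
    ((k.factorial : ℂ)⁻¹) • (Matrix.of fun x y => M x y ^ k : Matrix X X ℂ)) (fun n => ?_)
    fun x y => ?_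
  · refine Matrix.posSemidef_sum _ fun k _ => (posSemidef_entrywise_pow hM k).smul ?_
    have : (0 : ℂ) ≤ (((k.factorial : ℝ)⁻¹ : ℝ) : ℂ) := by
      rw [Complex.zero_le_real]; positivity
    simpa only [Complex.ofReal_inv, Complex.ofReal_natCast] using this
  · have := (NormedSpace.expSeries_div_hasSum_exp (M x y)).tendsto_sum_nat
    rw [← Complex.exp_eq_exp_ℂ] at this
    refine this.congr fun n => ?_
    simp [Matrix.sum_apply, div_eq_inv_mul]

/-- The Gaussian kernel `exp (-‖x - y‖²)` on an inner product space. -/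
noncomputable def gaussianKernel (H : Type*) [NormedAddCommGroup H] : Matrix H H ℂ :=
  Matrix.of fun x y => (Real.exp (-‖x - y‖ ^ 2) : ℂ)

/-- The Gaussian kernel is positive semidefinite, since
`exp (-‖x - y‖²) = exp (-‖x‖²) exp (-‖y‖²) exp (⟪x, y⟫ + ⟪y, x⟫)`. -/
lemma posSemidef_gaussianKernel (H : Type*) [NormedAddCommGroup H] [InnerProductSpace ℂ H] :
    (gaussianKernel H).PosSemidef := by
  have h0 := posSemidef_gram_of_family (id : H → H)
  have h1 := posSemidef_entrywise_exp (h0.add h0.transpose)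
  have h2 := posSemidef_gram_of_family fun x : H => (Real.exp (-‖x‖ ^ 2) : ℂ)
  refine posSemidef_of_eq (h2.hadamard h1) ?_
  ext x y
  have h3 : inner ℂ x y + inner ℂ y x
      = ((‖x‖ ^ 2 + ‖y‖ ^ 2 - ‖x - y‖ ^ 2 : ℝ) : ℂ) := by
    rw [@norm_sub_sq ℂ, ← inner_conj_symm y x, Complex.add_conj]
    push_cast
    simp
  simp only [gaussianKernel, Matrix.hadamard_apply, Matrix.of_apply, Matrix.add_apply,
    Matrix.transpose_apply, id, h3, RCLike.inner_apply, Complex.conj_ofReal]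
  rw [← Complex.ofReal_exp, ← Complex.ofReal_mul, ← Complex.ofReal_mul, ← Real.exp_add,
    ← Real.exp_add]
  congr 2
  ring

/-- The block diagonal kernel on `ℕ × H` whose blocks are the Gaussian kernels
`exp (-‖x - y‖² / (n + 1)²)` of growing width. -/
noncomputable def widthKernel (H : Type*) [NormedAddCommGroup H] : Matrix (ℕ × H) (ℕ × H) ℂ :=
  Matrix.of fun p q =>
    if p.1 = q.1 then (Real.exp (-(‖p.2 - q.2‖ / (p.1 + 1)) ^ 2) : ℂ) else 0

lemma posSemidef_widthKernel (H : Type*) [NormedAddCommGroup H] [InnerProductSpace ℂ H] :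
    (widthKernel H).PosSemidef := by
  have h1 := (Matrix.PosSemidef.one (n := ℕ) (R := ℂ)).submatrix (Prod.fst : ℕ × H → ℕ)
  have h2 := (posSemidef_gaussianKernel H).submatrix
    (fun p : ℕ × H => ((p.1 + 1 : ℂ)⁻¹) • p.2)
  refine posSemidef_of_eq (h1.hadamard h2) ?_
  ext p q
  obtain ⟨n, x⟩ := p
  obtain ⟨m, y⟩ := q
  by_cases h : n = m
  · subst h
    have h3 : ‖(n + 1 : ℂ)⁻¹‖ = ((n : ℝ) + 1)⁻¹ := by
      rw [norm_inv]
      norm_cast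
    simp [widthKernel, gaussianKernel, ← smul_sub, norm_smul, h3, div_eq_inv_mul]
  · simp [widthKernel, h]

/-- Moore's theorem for scalar kernels: a positive semidefinite complex matrix, of any size, is
the Gram matrix of a total family of vectors in a Hilbert space. -/
lemma exists_total_gram_eq {X : Type u} {k : Matrix X X ℂ} (hk : k.PosSemidef) :
    ∃ (E : Type u) (_ : NormedAddCommGroup E) (_ : InnerProductSpace ℂ E) (_ : CompleteSpace E)
      (e : X → E), (Submodule.span ℂ (Set.range e)).topologicalClosure = ⊤ ∧
        ∀ x y, inner ℂ (e x) (e y) = k x y := by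
  -- Mathlib's construction takes operator-valued kernels: scalars act on the fibre `ℂ`.
  let K : Matrix X X (ℂ →L[ℂ] ℂ) := Matrix.of fun x y => k x y • ContinuousLinearMap.id ℂ ℂ
  have hK : K.PosSemidef := by
    have h := (RKHS.posSemidef_tfae (K := K)).out 0 2
    refine h.2 ⟨?_, fun c => ?_⟩
    · ext x y
      simp only [Matrix.conjTranspose_apply, K, Matrix.of_apply, star_smul,
        hk.isHermitian.apply, ← ContinuousLinearMap.one_def, star_one]
    · have := (Complex.le_def.1 (hk.2 c)).1
      simpa only [K, Matrix.of_apply, smul_apply, ContinuousLinearMap.id_apply,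
        smul_eq_mul, RCLike.inner_apply, map_mul, ← Complex.star_def, hk.isHermitian.apply,
        mul_comm, mul_left_comm, Complex.zero_re, RCLike.re_eq_complex_re] using this
  have : Fact K.PosSemidef := ⟨hK⟩
  refine ⟨RKHS.OfKernel K, inferInstance, inferInstance, inferInstance,
    fun x => RKHS.kerFun (RKHS.OfKernel K) x 1, ?_, fun x y => ?_⟩
  · have := RKHS.kerFun_dense (RKHS.OfKernel K)
    rw [eq_top_iff, ← this]
    refine Submodule.topologicalClosure_mono (Submodule.span_le.2 ?_)
    rintro _ ⟨x, v, rfl⟩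
    have h : RKHS.kerFun (RKHS.OfKernel K) x v = v • RKHS.kerFun (RKHS.OfKernel K) x 1 := by
      rw [← map_smul, smul_eq_mul, mul_one]
    rw [h]
    exact Submodule.smul_mem _ _ (Submodule.subset_span ⟨x, rfl⟩)
  · rw [← RKHS.kernel_inner, RKHS.OfKernel.kernel_ofKernel]
    simpa [K] using hk.isHermitian.apply x y

end GaussianKernel

/-! ### Unitary representations on spaces with a total family -/

section Representations

variable {G : Type*} [Group G] {X : Type*} {E : Type*} [NormedAddCommGroup E]
  [InnerProductSpace ℂ E]

/-- A closed subspace containing a total family is everything. Here and below a family `e` is total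
if the closed span of its range is `⊤`. -/
lemma mem_closed_of_total {e : X → E} (he : (Submodule.span ℂ (Set.range e)).topologicalClosure = ⊤)
    (S : Submodule ℂ E) (hS : IsClosed (S : Set E)) (h : ∀ x, e x ∈ S) (ξ : E) : ξ ∈ S := by
  have h1 : (Submodule.span ℂ (Set.range e)).topologicalClosure ≤ S :=
    Submodule.topologicalClosure_minimal _ (Submodule.span_le.2 (Set.range_subset_iff.2 h)) hS
  exact h1 (he ▸ Submodule.mem_top)

/-- An action on a total family of vectors that preserves inner products extends to a unitary
representation. -/
lemma exists_unitaryRep_of_perm [CompleteSpace E] (α : G →* Equiv.Perm X) {e : X → E}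
    (he : (Submodule.span ℂ (Set.range e)).topologicalClosure = ⊤)
    (hα : ∀ g x y, inner ℂ (e (α g x)) (e (α g y)) = (inner ℂ (e x) (e y) : ℂ)) :
    ∃ π : G →* (E ≃ₗᵢ[ℂ] E), ∀ g x, π g (e x) = e (α g x) := by
  let T : (X →₀ ℂ) →ₗ[ℂ] E := Finsupp.linearCombination ℂ e
  have hT : DenseRange T := by
    rw [DenseRange, ← LinearMap.coe_range, Finsupp.range_linearCombination, dense_iff_closure_eq,
      ← Submodule.topologicalClosure_coe, he, Submodule.top_coe]
  let f : G → ((X →₀ ℂ) ≃ₗ[ℂ] (X →₀ ℂ)) := fun g => Finsupp.domLCongr (α g)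
  have hf : ∀ g c, ‖T (f g c)‖ = ‖T c‖ := by
    intro g c
    have h1 : T (f g c) = c.sum fun x a => a • e (α g x) := by
      simp only [T, f, Finsupp.linearCombination_apply, Finsupp.domLCongr_apply,
        Finsupp.domCongr_apply, Finsupp.equivMapDomain_eq_mapDomain]
      rw [Finsupp.sum_mapDomain_index (by simp) (by simp [add_smul])]
    have h2 : T c = c.sum fun x a => a • e x := Finsupp.linearCombination_apply ℂ c
    rw [h1, h2, @norm_eq_sqrt_re_inner ℂ, @norm_eq_sqrt_re_inner ℂ]
    simp only [Finsupp.sum, sum_inner, inner_sum, inner_smul_left, inner_smul_right, hα]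
  let U : G → (E ≃ₗᵢ[ℂ] E) := fun g => (f g).extendOfIsometry T T hT hT (hf g)
  have hU : ∀ g x, U g (e x) = e (α g x) := by
    intro g x
    have h := LinearEquiv.extendOfIsometry_eq (f := f g) (e₁ := T) (e₂ := T) hT hT (hf g)
      (Finsupp.single x 1)
    simpa [T, f] using h
  have ext : ∀ V W : E ≃ₗᵢ[ℂ] E, (∀ x, V (e x) = W (e x)) → V = W := by
    intro V W h
    ext ξ
    exact mem_closed_of_total he
      (LinearMap.eqLocus V.toLinearEquiv.toLinearMap W.toLinearEquiv.toLinearMap)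
      (isClosed_eq V.continuous W.continuous) h ξ
  refine ⟨⟨⟨U, ext _ _ fun x => ?_⟩, fun g h => ext _ _ fun x => ?_⟩, hU⟩
  · simp [hU]
  · simp [hU]

variable [TopologicalSpace G]

lemma normContinuous_of_total {π : G →* (E ≃ₗᵢ[ℂ] E)} {e : X → E}
    (he : (Submodule.span ℂ (Set.range e)).topologicalClosure = ⊤)
    (h : ∀ x, Continuous fun t => π t (e x)) : NormContinuous π := by
  let S : Submodule ℂ E :=
    { carrier := {ξ | Continuous fun t => π t ξ}
      add_mem' := fun {ξ η} hξ hη => by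
        simp only [Set.mem_ofPred_eq, map_add] at *
        exact hξ.add hη
      zero_mem' := by simpa using continuous_const
      smul_mem' := fun c ξ hξ => by
        simp only [Set.mem_ofPred_eq, map_smul] at *
        exact hξ.const_smul c }
  refine mem_closed_of_total he S (isClosed_of_closure_subset fun ξ hξ => ?_) h
  refine continuous_of_uniform_approx_of_continuous fun u hu => ?_
  obtain ⟨ε, hε, hεu⟩ := Metric.mem_uniformity_dist.1 hu
  obtain ⟨η, hη, hd⟩ := Metric.mem_closure_iff.1 hξ ε hε
  exact ⟨fun t => π t η, hη, fun t => hεu (by rwa [(π t).dist_map])⟩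

end Representations

/-! ### Cocycles and property (T) -/

section Cocycles

variable {G : Type u} [Group G]

/-- `b` is a `1`-cocycle for `π`; equivalently `x ↦ π t x + b t` is an action of `G` by affine
isometries. -/
def IsCocycle {H : Type*} [NormedAddCommGroup H] [InnerProductSpace ℂ H]
    (π : G →* (H ≃ₗᵢ[ℂ] H)) (b : G → H) : Prop :=
  ∀ s t, b (s * t) = b s + π s (b t)

lemma IsCocycle.map_one {H : Type*} [NormedAddCommGroup H] [InnerProductSpace ℂ H]
    {π : G →* (H ≃ₗᵢ[ℂ] H)} {b : G → H} (hb : IsCocycle π b) : b 1 = 0 := by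
  have h := hb 1 1
  simpa using h

/-- The affine isometric action `x ↦ π t x + b t` on the second factor of `ℕ × H`. -/
def IsCocycle.affineAction {H : Type*} [NormedAddCommGroup H] [InnerProductSpace ℂ H]
    {π : G →* (H ≃ₗᵢ[ℂ] H)} {b : G → H} (hb : IsCocycle π b) : G →* Equiv.Perm (ℕ × H) where
  toFun t := (Equiv.refl ℕ).prodCongr ((π t).toEquiv.trans (Equiv.addRight (b t)))
  map_one' := by ext x <;> simp [hb.map_one]
  map_mul' s t := by ext x <;> simp [hb s t, add_comm, add_left_comm]

lemma IsCocycle.affineAction_apply {H : Type*} [NormedAddCommGroup H] [InnerProductSpace ℂ H]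
    {π : G →* (H ≃ₗᵢ[ℂ] H)} {b : G → H} (hb : IsCocycle π b) (t : G) (p : ℕ × H) :
    hb.affineAction t p = (p.1, π t p.2 + b t) := rfl

lemma widthKernel_self {H : Type*} [NormedAddCommGroup H] (p : ℕ × H) : widthKernel H p p = 1 := by
  simp [widthKernel]

section WidthKernel

variable {H : Type*} [NormedAddCommGroup H] {E : Type*} [NormedAddCommGroup E]
  [InnerProductSpace ℂ E] {e : ℕ × H → E}

lemma norm_eq_one_of_inner_eq_widthKernel
    (hk : ∀ p q, inner ℂ (e p) (e q) = widthKernel H p q) (p : ℕ × H) : ‖e p‖ = 1 := by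
  have h := hk p p
  rw [widthKernel_self, inner_self_eq_norm_sq_to_K] at h
  have h2 : ((‖e p‖ ^ 2 : ℝ) : ℂ) = 1 := by simpa using h
  exact (pow_eq_one_iff_of_nonneg (norm_nonneg _) two_ne_zero).1 (Complex.ofReal_eq_one.1 h2)

lemma norm_sub_le_of_inner_eq_widthKernel
    (hk : ∀ p q, inner ℂ (e p) (e q) = widthKernel H p q) (n : ℕ) (x y : H) :
    ‖e (n, x) - e (n, y)‖ ≤ 2 * (‖x - y‖ / (n + 1)) := by
  refine abs_le_of_sq_le_sq' ?_ (by positivity) |>.2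
  rw [@norm_sub_sq ℂ, hk, norm_eq_one_of_inner_eq_widthKernel hk,
    norm_eq_one_of_inner_eq_widthKernel hk]
  simp only [widthKernel, Matrix.of_apply, if_true, RCLike.re_to_complex, Complex.ofReal_re]
  nlinarith [Real.add_one_le_exp (-(‖x - y‖ / (n + 1)) ^ 2), sq_nonneg (‖x - y‖ / (n + 1))]

/-- Kernel vectors whose base points run off to infinity converge weakly to `0`. -/
lemma tendsto_inner_of_inner_eq_widthKernel
    (he : (Submodule.span ℂ (Set.range e)).topologicalClosure = ⊤)
    (hk : ∀ p q, inner ℂ (e p) (e q) = widthKernel H p q) (n : ℕ) {x : ℕ → H}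
    (hx : Filter.Tendsto (fun i => ‖x i‖) Filter.atTop Filter.atTop) (ξ : E) :
    Filter.Tendsto (fun i => (inner ℂ (e (n, x i)) ξ : ℂ)) Filter.atTop (𝓝 0) := by
  let S : Submodule ℂ E :=
    { carrier := {ξ | Filter.Tendsto (fun i => (inner ℂ (e (n, x i)) ξ : ℂ)) Filter.atTop (𝓝 0)}
      add_mem' := fun {ξ η} hξ hη => by
        simp only [Set.mem_ofPred_eq, inner_add_right] at *
        simpa using hξ.add hη
      zero_mem' := by simp
      smul_mem' := fun c ξ hξ => by
        simp only [Set.mem_ofPred_eq, inner_smul_right] at *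
        simpa using hξ.const_mul c }
  refine mem_closed_of_total he S (isClosed_of_closure_subset fun ξ hξ => ?_) (fun p => ?_) ξ
  · refine Metric.tendsto_atTop.2 fun ε hε => ?_
    obtain ⟨η, hη, hd⟩ := Metric.mem_closure_iff.1 hξ (ε / 2) (by positivity)
    obtain ⟨N, hN⟩ := Metric.tendsto_atTop.1 (show Filter.Tendsto _ _ _ from hη) (ε / 2)
      (by positivity)
    refine ⟨N, fun i hi => ?_⟩
    have h1 := hN i hi
    rw [dist_zero_right] at h1 ⊢
    have h2 : ‖(inner ℂ (e (n, x i)) (ξ - η) : ℂ)‖ ≤ ‖ξ - η‖ := by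
      have := norm_inner_le_norm (𝕜 := ℂ) (e (n, x i)) (ξ - η)
      rwa [norm_eq_one_of_inner_eq_widthKernel hk, one_mul] at this
    have h3 : (inner ℂ (e (n, x i)) ξ : ℂ)
        = inner ℂ (e (n, x i)) η + inner ℂ (e (n, x i)) (ξ - η) := by
      rw [← inner_add_right]; congr 1; abel
    rw [dist_eq_norm] at hd
    rw [h3]
    linarith [norm_add_le (inner ℂ (e (n, x i)) η : ℂ) (inner ℂ (e (n, x i)) (ξ - η))]
  · obtain ⟨m, y⟩ := p
    change Filter.Tendsto (fun i => (inner ℂ (e (n, x i)) (e (m, y)) : ℂ)) _ _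
    simp only [hk, widthKernel, Matrix.of_apply]
    by_cases hnm : n = m
    · simp only [hnm, if_true]
      have h1 : Filter.Tendsto (fun i => ‖x i - y‖ / (m + 1 : ℝ)) Filter.atTop Filter.atTop := by
        refine Filter.Tendsto.atTop_div_const (by positivity) ?_
        refine Filter.tendsto_atTop_mono (fun i => norm_sub_norm_le (x i) y) ?_
        exact Filter.tendsto_atTop_add_const_right _ (-‖y‖) hx
      have h2 := (Real.tendsto_exp_neg_atTop_nhds_zero.comp
        ((Filter.tendsto_pow_atTop two_ne_zero).comp h1))
      have h3 := (Complex.continuous_ofReal.tendsto 0).comp h2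
      rw [Complex.ofReal_zero] at h3
      exact h3
    · simp [hnm]

end WidthKernel

variable [TopologicalSpace G]

/-- Property (T) forces continuous cocycles to be bounded. For a cocycle `b`, the Hilbert space of
the kernel `widthKernel` carries the unitary representation induced by the affine action; its
kernel vectors at the origin are almost invariant as the width grows, while an unbounded `b` makes
the orbits of kernel vectors converge weakly to `0`, which excludes invariant vectors. -/
theorem PropertyT.isBounded_cocycle (hG : PropertyT.{u, v} G) {H : Type (max u v)}
    [NormedAddCommGroup H] [InnerProductSpace ℂ H] {π : G →* (H ≃ₗᵢ[ℂ] H)}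
    (hπ : NormContinuous π) {b : G → H} (hb : IsCocycle π b) (hc : Continuous b) :
    ∃ C, ∀ t, ‖b t‖ ≤ C := by
  by_contra! hC
  choose t ht using fun n : ℕ => hC n
  obtain ⟨E, _, _, _, e, he, hk⟩ := exists_total_gram_eq (posSemidef_widthKernel H)
  have hn := norm_eq_one_of_inner_eq_widthKernel hk
  have hl := norm_sub_le_of_inner_eq_widthKernel hk
  obtain ⟨ρ, hρ⟩ := exists_unitaryRep_of_perm hb.affineAction he fun g p q => by
    simp only [hk, widthKernel, Matrix.of_apply, hb.affineAction_apply, add_sub_add_right_eq_sub,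
      ← map_sub, LinearIsometryEquiv.norm_map]
  have hcont : NormContinuous ρ := by
    refine normContinuous_of_total he fun p => ?_
    simp only [hρ, hb.affineAction_apply]
    refine continuous_iff_continuousAt.2 fun s => ?_
    refine tendsto_iff_norm_sub_tendsto_zero.2 ?_
    refine squeeze_zero (fun _ => norm_nonneg _) (fun s' => hl p.1 _ _) ?_
    have h1 : Continuous fun s' => 2 * (‖π s' p.2 + b s' - (π s p.2 + b s)‖ / (p.1 + 1)) := by
      have := hπ p.2
      fun_prop
    simpa using h1.tendsto s
  have hinv : HasAlmostInvariantUnitVectors ρ := by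
    intro Q hQ ε hε
    obtain ⟨C, hC⟩ := hQ.exists_bound_of_continuousOn hc.continuousOn
    obtain ⟨n, hn'⟩ := exists_nat_gt (2 * C / ε)
    refine ⟨e (n, 0), hn _, fun t ht => ?_⟩
    rw [hρ, hb.affineAction_apply]
    refine (hl n _ _).trans_lt ?_
    simp only [map_zero, zero_add, sub_zero]
    rw [div_lt_iff₀ hε] at hn'
    rw [← mul_div_assoc, div_lt_iff₀ (by positivity)]
    nlinarith [hC t ht]
  obtain ⟨ξ, hξ0, hξ⟩ := hG E ρ hcont hinv
  refine hξ0 ?_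
  have horth : ∀ p, (inner ℂ (e p) ξ : ℂ) = 0 := by
    intro p
    have h1 : Filter.Tendsto (fun i => ‖π (t i) p.2 + b (t i)‖) Filter.atTop Filter.atTop := by
      refine Filter.tendsto_atTop_mono (f := fun i : ℕ => (i : ℝ) - ‖p.2‖) (fun i => ?_) ?_
      · have := norm_sub_le (π (t i) p.2 + b (t i)) (π (t i) p.2)
        rw [add_sub_cancel_left, LinearIsometryEquiv.norm_map] at this
        linarith [ht i]
      · exact Filter.tendsto_atTop_add_const_right _ (-‖p.2‖) tendsto_natCast_atTop_atTop
    have h2 := tendsto_inner_of_inner_eq_widthKernel he hk p.1 h1 ξ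
    have h3 : ∀ i, (inner ℂ (e (p.1, π (t i) p.2 + b (t i))) ξ : ℂ) = inner ℂ (e p) ξ := by
      intro i
      rw [← hb.affineAction_apply, ← hρ]
      conv_lhs => rw [← hξ (t i)]
      exact (ρ (t i)).inner_map_map _ _
    simp only [h3] at h2
    exact tendsto_nhds_unique tendsto_const_nhds h2
  have := mem_closed_of_total he (LinearMap.ker (innerSL ℂ ξ).toLinearMap)
    (innerSL ℂ ξ).isClosed_ker (fun p => ?_) ξ
  · simpa using this
  · rw [LinearMap.mem_ker]
    exact inner_eq_zero_symm.1 (horth p)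

end Cocycles

/-! ### Unbounded cocycles in the absence of property (T) -/

section DirectSum

variable {G : Type u} [Group G] {H : Type*} [NormedAddCommGroup H] [InnerProductSpace ℂ H]
  [CompleteSpace H]

/-- If an orbit stays within a distance of its base point `ξ` smaller than `‖ξ‖`, then the element
of minimal norm of its closed convex hull is a non-zero invariant vector. -/
lemma hasNonzeroInvariantVector_of_norm_sub_le (π : G →* (H ≃ₗᵢ[ℂ] H)) {ξ : H} {c : ℝ}
    (hc : c < ‖ξ‖) (h : ∀ t, ‖π t ξ - ξ‖ ≤ c) : HasNonzeroInvariantVector π := by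
  let : InnerProductSpace ℝ H := InnerProductSpace.rclikeToReal ℂ H
  let C : Set H := closedConvexHull ℝ (Set.range fun t => π t ξ)
  have hCconv : Convex ℝ C := convex_closedConvexHull
  have hsub : ∀ t, π t ξ ∈ C := fun t => subset_closedConvexHull ⟨t, rfl⟩
  obtain ⟨v, hv, hvmin⟩ := exists_norm_eq_iInf_of_complete_convex (K := C) ⟨_, hsub 1⟩
    isClosed_closedConvexHull.isComplete hCconv 0
  -- The variational inequality at `v`, applied to `π t v`, which has the same norm as `v`, yields
  -- `π t v = v`.
  have hvar := (norm_eq_iInf_iff_real_inner_le_zero hCconv hv).1 hvmin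
  have hmaps : ∀ t, ∀ w ∈ C, π t w ∈ C := by
    intro t
    have hle : C ⊆ (π t) ⁻¹' C := by
      refine closedConvexHull_min ?_ ?_ (isClosed_closedConvexHull.preimage (π t).continuous)
      · rintro _ ⟨s, rfl⟩
        have := hsub (t * s)
        simpa using this
      · exact hCconv.linear_preimage ((π t).toLinearEquiv.toLinearMap.restrictScalars ℝ)
    exact fun w hw => hle hw
  refine ⟨v, ?_, fun t => ?_⟩
  · have hball : C ⊆ Metric.closedBall ξ c := by
      refine closedConvexHull_min ?_ (convex_closedBall _ _) Metric.isClosed_closedBall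
      rintro _ ⟨s, rfl⟩
      simpa [dist_eq_norm] using h s
    rintro rfl
    have := hball hv
    rw [mem_closedBall_iff_norm, zero_sub, norm_neg] at this
    linarith
  · have h1 := hvar _ (hmaps t v hv)
    have h2 : ‖π t v - v‖ ^ 2 ≤ 0 := by
      have h3 := @norm_sub_sq_real H _ _ (π t v) v
      rw [LinearIsometryEquiv.norm_map] at h3
      rw [zero_sub, inner_neg_left, inner_sub_right, real_inner_self_eq_norm_sq,
        real_inner_comm] at h1
      linarith
    have h4 : ‖π t v - v‖ = 0 := by
      have := sq_nonneg ‖π t v - v‖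
      exact pow_eq_zero_iff two_ne_zero |>.1 (le_antisymm h2 this)
    exact sub_eq_zero.1 (norm_eq_zero.1 h4)

variable [TopologicalSpace G]

/-- The Hilbert sum of countably many copies of a unitary representation. -/
lemma exists_countable_multiple {H : Type v} [NormedAddCommGroup H] [InnerProductSpace ℂ H]
    [CompleteSpace H] {π : G →* (H ≃ₗᵢ[ℂ] H)} (hπ : NormContinuous π) :
    ∃ (E : Type v) (_ : NormedAddCommGroup E) (_ : InnerProductSpace ℂ E) (_ : CompleteSpace E)
      (ρ : G →* (E ≃ₗᵢ[ℂ] E)) (e : ℕ → H →ₗᵢ[ℂ] E), NormContinuous ρ ∧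
        (∀ n t x, ρ t (e n x) = e n (π t x)) ∧
        ∀ m n x y, m ≠ n → (inner ℂ (e m x) (e n y) : ℂ) = 0 := by
  let e : ℕ → H →ₗᵢ[ℂ] lp (fun _ : ℕ => H) 2 := fun n =>
    { toLinearMap := lp.lsingle (𝕜 := ℂ) (E := fun _ : ℕ => H) 2 n
      norm_map' := fun x => lp.norm_single (p := 2) (E := fun _ : ℕ => H) two_pos n x }
  have hinner : ∀ m n x y, (inner ℂ (e m x) (e n y) : ℂ) = if m = n then inner ℂ x y else 0 := by
    intro m n x y
    change inner ℂ (lp.single (E := fun _ : ℕ => H) 2 m x) (lp.single (E := fun _ : ℕ => H) 2 n y)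
      = _
    rw [lp.inner_single_left, lp.single_apply]
    by_cases hmn : m = n
    · subst hmn; simp
    · simp [hmn]
  have he : (Submodule.span ℂ (Set.range fun p : ℕ × H => e p.1 p.2)).topologicalClosure = ⊤ := by
    refine eq_top_iff.2 fun f _ => ?_
    refine mem_closure_of_tendsto (lp.hasSum_single (by norm_num) f)
      (Filter.Eventually.of_forall fun s => ?_)
    exact Submodule.sum_mem _ fun n _ => Submodule.subset_span ⟨(n, f n), rfl⟩
  let α : G →* Equiv.Perm (ℕ × H) :=
    { toFun := fun t => (Equiv.refl ℕ).prodCongr (π t).toEquiv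
      map_one' := by ext x <;> simp
      map_mul' := fun s t => by ext x <;> simp }
  have hα : ∀ t p, α t p = (p.1, π t p.2) := fun _ _ => rfl
  obtain ⟨ρ, hρ⟩ := exists_unitaryRep_of_perm α he fun g p q => by
    simp only [hinner, hα, LinearIsometryEquiv.inner_map_map]
  refine ⟨lp (fun _ : ℕ => H) 2, inferInstance, inferInstance, inferInstance, ρ, e, ?_,
    fun n t x => hρ t (n, x), fun m n x y hmn => by rw [hinner, if_neg hmn]⟩
  refine normContinuous_of_total he fun p => ?_
  simp only [hρ, hα]
  exact (e p.1).continuous.comp (hπ p.2)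

/-- If a `σ`-compact group has a representation without non-zero invariant vectors but with almost
invariant unit vectors `ξ n`, of quality improving with `n` along a compact exhaustion, then
the cocycle with components `(n + 1) (π t (ξ n) - ξ n)` in the Hilbert sum of countably many copies
of `π` is continuous and unbounded. -/
theorem propertyT_of_isBounded_cocycle [LocallyCompactSpace G] [SigmaCompactSpace G]
    (h : ∀ (H : Type (max u v)) [NormedAddCommGroup H] [InnerProductSpace ℂ H] [CompleteSpace H]
      (π : G →* (H ≃ₗᵢ[ℂ] H)), NormContinuous π → ∀ b : G → H, IsCocycle π b → Continuous b →
        ∃ C, ∀ t, ‖b t‖ ≤ C) : PropertyT.{u, v} G := by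
  intro H _ _ _ π hπ hai
  let K : CompactExhaustion G := default
  choose ξ hξ1 hξ using fun n : ℕ =>
    hai (K n) (K.isCompact n) ((1 / 2) ^ n / (n + 1)) (by positivity)
  obtain ⟨E, _, _, _, ρ, e, hρc, hρ, horth⟩ := exists_countable_multiple hπ
  let β : ℕ → G → H := fun n t => ((n : ℂ) + 1) • (π t (ξ n) - ξ n)
  have hn1 : ∀ n : ℕ, ‖(n : ℂ) + 1‖ = n + 1 := fun n => by norm_cast
  have hβnorm : ∀ n t, ‖β n t‖ = (n + 1) * ‖π t (ξ n) - ξ n‖ := fun n t => by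
    rw [norm_smul, hn1]
  have hβ : ∀ n, IsCocycle π (β n) := by
    intro n s t
    simp only [β, map_mul, LinearIsometryEquiv.coe_mul, Function.comp_apply, map_smul, map_sub,
      ← smul_add]
    congr 1
    abel
  -- On `K N` the components of index `n < N` satisfy only the trivial bound `2 (n + 1)`.
  let w : ℕ → ℕ → ℝ := fun N n => (if n < N then 2 * ((n : ℝ) + 1) else 0) + (1 / 2) ^ n
  have hw : ∀ N, Summable (w N) := fun N =>
    (summable_of_ne_finset_zero (s := Finset.range N) fun n hn => by
      simpa using fun h => (hn (Finset.mem_range.2 h)).elim).add summable_geometric_two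
  have hbound : ∀ N n, ∀ t ∈ K N, ‖e n (β n t)‖ ≤ w N n := by
    intro N n t ht
    rw [LinearIsometry.norm_map, hβnorm]
    by_cases hn : n < N
    · have h1 : ‖π t (ξ n) - ξ n‖ ≤ 2 := by
        refine (norm_sub_le _ _).trans ?_
        rw [LinearIsometryEquiv.norm_map, hξ1]
        norm_num
      simp only [w, hn, if_true]
      have : (0 : ℝ) ≤ (1 / 2) ^ n := by positivity
      nlinarith
    · have h1 := (hξ n t (K.subset (not_lt.1 hn) ht)).le
      rw [le_div_iff₀ (by positivity)] at h1
      simp only [w, hn, if_false]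
      linarith
  have hex : ∀ t, ∃ N, K N ∈ 𝓝 t := K.exists_mem_nhds
  have hsum : ∀ t, Summable fun n => e n (β n t) := fun t => by
    obtain ⟨N, hN⟩ := hex t
    exact Summable.of_norm_bounded (hw N) fun n => hbound N n t (mem_of_mem_nhds hN)
  let b : G → E := fun t => ∑' n, e n (β n t)
  have hbcoc : IsCocycle ρ b := by
    intro s t
    have h1 : ρ s (b t) = ∑' n, e n (π s (β n t)) := by
      simp only [b]
      rw [← LinearIsometryEquiv.coe_toContinuousLinearEquiv, ContinuousLinearEquiv.map_tsum]
      exact tsum_congr fun n => hρ n s (β n t)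
    have h2 : Summable fun n => e n (π s (β n t)) := by
      refine ((hsum (s * t)).sub (hsum s)).congr fun n => ?_
      simp only [hβ n s t, map_add]
      abel
    rw [h1]
    simp only [b]
    rw [← (hsum s).tsum_add h2]
    refine tsum_congr fun n => ?_
    simp only [hβ n s t, map_add]
  have hbcont : Continuous b := by
    refine continuous_iff_continuousAt.2 fun t => ?_
    obtain ⟨N, hN⟩ := hex t
    refine ContinuousOn.continuousAt (continuousOn_tsum (fun n => ?_) (hw N) (hbound N)) hN
    refine Continuous.continuousOn ?_
    refine (e n).continuous.comp ?_
    exact ((hπ (ξ n)).sub continuous_const).const_smul _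
  obtain ⟨C, hC⟩ := h E ρ hρc b hbcoc hbcont
  have hcomp : ∀ n t, ‖β n t‖ ≤ C := by
    intro n t
    have h1 : HasSum (fun m => (inner ℂ (e n (β n t)) (e m (β m t)) : ℂ))
        (inner ℂ (e n (β n t)) (b t)) := (hsum t).hasSum.mapL (innerSL ℂ (e n (β n t)))
    have h2 := hasSum_single (f := fun m => (inner ℂ (e n (β n t)) (e m (β m t)) : ℂ)) n
      fun m hm => horth _ _ _ _ hm.symm
    have h3 := norm_inner_le_norm (𝕜 := ℂ) (e n (β n t)) (b t)
    rw [h1.unique h2, LinearIsometry.inner_map_map, LinearIsometry.norm_map,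
      inner_self_eq_norm_sq_to_K, norm_pow, RCLike.norm_ofReal, abs_norm, sq] at h3
    by_contra! hlt
    exact absurd h3 (not_le.2 (mul_lt_mul_of_pos_left ((hC t).trans_lt hlt)
      ((norm_nonneg _).trans_lt ((hC t).trans_lt hlt))))
  obtain ⟨n, hn⟩ := exists_nat_gt C
  refine hasNonzeroInvariantVector_of_norm_sub_le π (ξ := ξ n) (c := C / (n + 1)) ?_ fun t => ?_
  · rw [hξ1, div_lt_one (by positivity)]
    linarith
  · rw [le_div_iff₀ (by positivity), mul_comm, ← hβnorm]
    exact hcomp n t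

end DirectSum

/-! ### Derivations and cocycles -/

section Derivations

section TestFunctions

variable {G : Type u} [TopologicalSpace G]

lemma exists_bump [RegularSpace G] [LocallyCompactSpace G] {U : Set G} (hU : IsOpen U) {K : Set G}
    (hK : IsCompact K) (hKU : K ⊆ U) : ∃ φ : C(G, ℝ), HasCompactSupport φ ∧ (∀ t ∈ K, φ t = 1) ∧
      (∀ t ∉ U, φ t = 0) ∧ ∀ t, 0 ≤ φ t := by
  obtain ⟨φ, h1, h0, hc, hpos⟩ := exists_continuous_one_zero_of_isCompact hK hU.isClosed_compl
    (Set.disjoint_compl_right_iff_subset.2 hKU)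
  exact ⟨φ, hc, h1, fun t ht => h0 ht, fun t => (hpos t).1⟩

/-- A compactly supported real function as an element of `C_c(G)`. -/
def complexOfReal (φ : C(G, ℝ)) (hφ : HasCompactSupport φ) : C_c(G, ℂ) where
  toFun t := (φ t : ℂ)
  continuous_toFun := by fun_prop
  hasCompactSupport' := hφ.comp_left (g := fun x : ℝ => (x : ℂ)) Complex.ofReal_zero

variable [MeasurableSpace G] [BorelSpace G] {H : Type*} [NormedAddCommGroup H]
  [InnerProductSpace ℂ H] {μ : Measure G}

lemma integrable_smul [IsFiniteMeasureOnCompacts μ] (f : C_c(G, ℂ)) {h : G → H}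
    (hh : Continuous h) : Integrable (fun t => f t • h t) μ :=
  (f.continuous.smul hh).integrable_of_hasCompactSupport f.hasCompactSupport.smul_right

lemma integrable_coe [IsFiniteMeasureOnCompacts μ] (f : C_c(G, ℂ)) : Integrable f μ :=
  f.continuous.integrable_of_hasCompactSupport f.hasCompactSupport

lemma norm_integral_smul_le [IsFiniteMeasureOnCompacts μ] (f : C_c(G, ℂ)) {h : G → H} {C : ℝ}
    (hC : ∀ t ∈ tsupport f, ‖h t‖ ≤ C) : ‖∫ t, f t • h t ∂μ‖ ≤ C * normL1 μ f := by
  rw [normL1, ← integral_const_mul]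
  refine norm_integral_le_of_norm_le ((integrable_coe f).norm.const_mul C)
    (Filter.Eventually.of_forall fun t => ?_)
  by_cases ht : t ∈ tsupport f
  · rw [norm_smul, mul_comm]
    exact mul_le_mul_of_nonneg_right (hC t ht) (norm_nonneg _)
  · simp [image_eq_zero_of_notMem_tsupport ht]

/-- Testing against bump functions: the supremum norm of a continuous function is at most its norm
as a functional on `C_c(G)` with the `L¹`-norm. -/
lemma norm_le_of_norm_integral_smul_le [RegularSpace G] [LocallyCompactSpace G]
    [IsFiniteMeasureOnCompacts μ] [μ.IsOpenPosMeasure] [CompleteSpace H] {h : G → H}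
    (hh : Continuous h) {κ : ℝ} (hκ0 : 0 ≤ κ)
    (hκ : ∀ f : C_c(G, ℂ), ‖∫ t, f t • h t ∂μ‖ ≤ κ * normL1 μ f) (t₀ : G) : ‖h t₀‖ ≤ κ := by
  by_contra! hlt
  -- The bump function lives where `h` has component larger than `κ` in the direction of `h t₀`.
  let q : G → ℝ := fun t => RCLike.re (inner ℂ (h t₀) (h t) : ℂ) - κ * ‖h t₀‖
  have hq : Continuous q := by fun_prop
  have hq0 : 0 < q t₀ := by
    simp only [q, inner_self_eq_norm_sq]
    have : 0 < ‖h t₀‖ := hκ0.trans_lt hlt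
    nlinarith
  obtain ⟨φ, hφc, hφ1, hφ0, hφ⟩ := exists_bump (isOpen_lt continuous_const hq)
    (isCompact_singleton (x := t₀)) (by simpa using hq0)
  let f := complexOfReal φ hφc
  have hf : normL1 μ f = ∫ t, φ t ∂μ := by
    refine integral_congr_ae (Filter.Eventually.of_forall fun t => ?_)
    change ‖(φ t : ℂ)‖ = φ t
    rw [Complex.norm_real, Real.norm_of_nonneg (hφ t)]
  have hφi : Integrable φ μ := φ.continuous.integrable_of_hasCompactSupport hφc
  have hint := integrable_smul (μ := μ) f hh
  have h1 : RCLike.re (inner ℂ (h t₀) (∫ t, f t • h t ∂μ) : ℂ)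
      = ∫ t, φ t * RCLike.re (inner ℂ (h t₀) (h t) : ℂ) ∂μ := by
    rw [← integral_inner hint, ← integral_re (hint.const_inner _)]
    refine integral_congr_ae (Filter.Eventually.of_forall fun t => ?_)
    change RCLike.re (inner ℂ (h t₀) ((φ t : ℂ) • h t) : ℂ) = _
    rw [inner_smul_right]
    simp
  have h2 : 0 < ∫ t, φ t * q t ∂μ := by
    refine (φ.continuous.mul hq).integral_pos_of_hasCompactSupport_nonneg_nonzero (x := t₀)
      hφc.mul_right (fun t => ?_) ?_
    · by_cases ht : 0 < q t
      · exact mul_nonneg (hφ t) ht.le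
      · simp [hφ0 t ht]
    · simpa [hφ1 t₀ rfl] using hq0.ne'
  have h3 : ∫ t, φ t * q t ∂μ = RCLike.re (inner ℂ (h t₀) (∫ t, f t • h t ∂μ) : ℂ)
      - κ * ‖h t₀‖ * ∫ t, φ t ∂μ := by
    rw [h1, ← integral_const_mul, ← integral_sub _ (hφi.const_mul _)]
    · refine integral_congr_ae (Filter.Eventually.of_forall fun t => ?_)
      simp only [q]
      ring
    · refine Continuous.integrable_of_hasCompactSupport ?_ hφc.mul_right
      fun_prop
  have h4 := (Complex.re_le_norm _).trans (norm_inner_le_norm (𝕜 := ℂ) (h t₀) (∫ t, f t • h t ∂μ))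
  have h5 := mul_le_mul_of_nonneg_left (hκ f) (norm_nonneg (h t₀))
  rw [hf] at h5
  rw [RCLike.re_to_complex] at h3
  nlinarith

/-- Integration of a continuous vector-valued function against functions in `C_c(G)`. -/
noncomputable def integrateAgainst (μ : Measure G) [IsFiniteMeasureOnCompacts μ] {b : G → H}
    (hb : Continuous b) : C_c(G, ℂ) →ₗ[ℂ] H where
  toFun f := ∫ t, f t • b t ∂μ
  map_add' f g := by
    rw [← integral_add (integrable_smul f hb) (integrable_smul g hb)]
    simp [add_smul]
  map_smul' c f := by
    rw [RingHom.id_apply, ← integral_smul]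
    simp [smul_smul]

lemma integrateAgainst_apply [IsFiniteMeasureOnCompacts μ] {b : G → H} (hb : Continuous b)
    (f : C_c(G, ℂ)) : integrateAgainst μ hb f = ∫ t, f t • b t ∂μ := rfl

end TestFunctions

variable {G : Type u} [Group G] [TopologicalSpace G]
  [MeasurableSpace G] [BorelSpace G] {H : Type*} [NormedAddCommGroup H] [InnerProductSpace ℂ H]
  {μ : Measure G}

/-- The integral of a continuous cocycle is continuously locally bounded, since the cocycle
vanishes at the identity. -/
lemma continuouslyLocallyBounded_integrateAgainst [IsFiniteMeasureOnCompacts μ] {b : G → H}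
    (hc : Continuous b) (h1 : b 1 = 0) :
    ContinuouslyLocallyBounded μ (integrateAgainst μ hc) := by
  refine ⟨fun K => ⨆ t : K, ‖b t‖₊, fun K f hf => ?_, fun ε hε => ?_⟩
  · refine norm_integral_smul_le f fun t ht => ?_
    have hbdd : BddAbove (Set.range fun t : K => ‖b t‖₊) := by
      have := (K.isCompact.image hc.nnnorm).bddAbove
      rwa [Set.image_eq_range] at this
    exact NNReal.coe_le_coe.2 (le_ciSup hbdd ⟨t, hf ht⟩)
  · refine ⟨{t | ‖b t‖ < ε / 2}, ?_, fun K hK => ?_⟩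
    · refine (isOpen_lt hc.norm continuous_const).mem_nhds ?_
      simpa [h1] using hε
    · have : Nonempty K := K.nonempty.to_subtype
      have hle : (⨆ t : K, ‖b t‖₊) ≤ (ε / 2).toNNReal := ciSup_le fun t => by
        rw [← norm_toNNReal]
        exact Real.toNNReal_le_toNNReal (hK t.2).le
      refine lt_of_le_of_lt (NNReal.coe_le_coe.2 hle) ?_
      rw [Real.coe_toNNReal _ (by positivity)]
      linarith

variable [IsTopologicalGroup G]

/-- The integral of a continuous cocycle is a derivation, by Fubini's theorem and the invariance of
Haar measure. -/
lemma isDerivation_integrateAgainst [T2Space G] [IsFiniteMeasureOnCompacts μ]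
    [μ.IsMulLeftInvariant] [CompleteSpace H]
    {π : G →* (H ≃ₗᵢ[ℂ] H)} (hπ : NormContinuous π) {b : G → H} (hb : IsCocycle π b)
    (hc : Continuous b) : IsDerivation μ π (integrateAgainst μ hc) := by
  intro f g
  have hinner : ∀ s, ∫ t, g (s⁻¹ * t) • b t ∂μ
      = augmentation μ g • b s + π s (integrateAgainst μ hc g) := by
    intro s
    rw [← integral_mul_left_eq_self _ s]
    have h1 : π s (integrateAgainst μ hc g) = ∫ t, π s (g t • b t) ∂μ :=
      ((π s).toContinuousLinearEquiv.integral_comp_comm _).symm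
    rw [augmentation, ← integral_smul_const, h1, ← integral_add]
    · refine integral_congr_ae (Filter.Eventually.of_forall fun t => ?_)
      simp [hb s t]
    · exact (integrable_coe g).smul_const _
    · exact (π s).toContinuousLinearEquiv.toContinuousLinearMap.integrable_comp
        (integrable_smul g hc)
  calc integrateAgainst μ hc (convol μ f g)
      = ∫ t, ∫ s, (f s * g (s⁻¹ * t)) • b t ∂μ ∂μ := by
        rw [integrateAgainst_apply]
        refine integral_congr_ae (Filter.Eventually.of_forall fun t => ?_)
        exact (integral_smul_const _ _).symm
    _ = ∫ s, ∫ t, (f s * g (s⁻¹ * t)) • b t ∂μ ∂μ := by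
        refine integral_integral_swap_of_hasCompactSupport ?_ ?_
        · simp only [Function.uncurry_def]
          fun_prop
        · refine HasCompactSupport.intro ((f.hasCompactSupport.isCompact.mul
            g.hasCompactSupport.isCompact).prod f.hasCompactSupport.isCompact) fun p hp => ?_
          have h0 : f p.2 * g (p.2⁻¹ * p.1) = 0 := by
            by_contra hne
            have hf := subset_tsupport f (left_ne_zero_of_mul hne)
            have hg := subset_tsupport g (right_ne_zero_of_mul hne)
            exact hp ⟨Set.mem_mul.2 ⟨p.2, hf, _, hg, by group⟩, hf⟩
          simp [Function.uncurry_def, h0]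
    _ = ∫ s, (f s • π s (integrateAgainst μ hc g) + augmentation μ g • f s • b s) ∂μ := by
        refine integral_congr_ae (Filter.Eventually.of_forall fun s => ?_)
        simp only [mul_smul]
        rw [integral_smul, hinner, smul_add, smul_comm, add_comm]
    _ = _ := by
        refine (integral_add (integrable_smul f (hπ _))
          (g := fun s => augmentation μ g • f s • b s) ((integrable_smul f hc).smul _)).trans ?_
        rw [integral_smul]
        rfl

end Derivations

/-! ### The cocycle of a locally bounded derivation -/

section CocycleOfDerivation

open scoped BoundedContinuousFunction

section Interchange

variable {G : Type u} [TopologicalSpace G]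

/-- The bounded continuous functions on `G` that vanish off `K`. -/
def vanishingOff (K : Set G) : Submodule ℂ (G →ᵇ ℂ) where
  carrier := {f | ∀ t ∉ K, f t = 0}
  add_mem' hf hg t ht := by simp [hf t ht, hg t ht]
  zero_mem' t _ := rfl
  smul_mem' c f hf t ht := by simp [hf t ht]

instance completeSpace_vanishingOff (K : Set G) : CompleteSpace (vanishingOff K) := by
  have : (vanishingOff K : Set (G →ᵇ ℂ)) = ⋂ t ∈ Kᶜ, {f : G →ᵇ ℂ | f t = 0} := by
    ext f
    simp only [Set.mem_iInter, Set.mem_compl_iff]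
    rfl
  have hclosed : IsClosed (vanishingOff K : Set (G →ᵇ ℂ)) := by
    rw [this]
    exact isClosed_biInter fun t _ => isClosed_eq (by fun_prop) continuous_const
  exact hclosed.completeSpace_coe

variable [T2Space G]

/-- A continuous function vanishing off a compact set, as an element of `C_c(G)`. -/
def toCc {K : Set G} (hK : IsCompact K) : vanishingOff K →ₗ[ℂ] C_c(G, ℂ) where
  toFun f :=
    { toContinuousMap := (f : G →ᵇ ℂ).toContinuousMap
      hasCompactSupport' := HasCompactSupport.intro hK f.2 }
  map_add' _ _ := rfl
  map_smul' _ _ := rfl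

lemma tsupport_toCc_subset {K : Set G} (hK : IsCompact K) (f : vanishingOff K) :
    tsupport (toCc hK f) ⊆ K :=
  closure_minimal (fun t ht => by_contra fun h => ht (f.2 t h)) hK.isClosed

/-- A family `F` in `C_c(G)`, jointly continuous and with supports in a fixed compact set, as a
continuous map to a Banach space of functions. -/
lemma exists_continuous_lift {K : Set G} (hK : IsCompact K) {F : G → C_c(G, ℂ)}
    (hF : Continuous fun p : G × G => F p.1 p.2) (hFK : ∀ s, ∀ t ∉ K, F s t = 0) :
    ∃ Φ : G → vanishingOff K, Continuous Φ ∧ ∀ s, toCc hK (Φ s) = F s := by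
  choose C hC using fun s => (F s).hasCompactSupport.exists_bound_of_continuous (F s).continuous
  let Φ : G → vanishingOff K := fun s =>
    ⟨BoundedContinuousFunction.ofNormedAddCommGroup (F s) (F s).continuous (C s) (hC s), hFK s⟩
  refine ⟨Φ, ?_, fun s => rfl⟩
  refine Metric.continuous_iff'.2 fun q ε hε => ?_
  obtain ⟨v, hv, hvK⟩ := hK.mem_uniformity_of_prod (f := fun s t => F s t) (s := Set.univ) (q := q)
    hF.continuousOn (Set.mem_univ q) (Metric.dist_mem_uniformity (half_pos hε))
  rw [nhdsWithin_univ] at hv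
  filter_upwards [hv] with p hp
  refine lt_of_le_of_lt ((BoundedContinuousFunction.dist_le (half_pos hε).le).2 fun t => ?_)
    (half_lt_self hε)
  by_cases ht : t ∈ K
  · exact (hvK p hp t ht).le
  · change dist (F p t) (F q t) ≤ ε / 2
    rw [hFK p t ht, hFK q t ht, dist_self]
    exact (half_pos hε).le

variable [MeasurableSpace G] {H : Type*} [NormedAddCommGroup H] [InnerProductSpace ℂ H]
  {μ : Measure G} [IsFiniteMeasureOnCompacts μ]
  {θ : C_c(G, ℂ) →ₗ[ℂ] H}

/-- A locally bounded map is continuous for the supremum norm on functions vanishing off a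
compact set, which has finite measure. -/
lemma LocallyBounded.exists_continuousLinearMap (hθ : LocallyBounded μ θ) {K : Set G}
    (hK : IsCompact K) (hne : K.Nonempty) :
    ∃ T : vanishingOff K →L[ℂ] H, ∀ f, T f = θ (toCc hK f) := by
  obtain ⟨κ, hκ⟩ := hθ ⟨⟨K, hK⟩, hne⟩
  refine ⟨(θ ∘ₗ toCc hK).mkContinuous (κ * μ.real K) fun f => ?_, fun f => rfl⟩
  refine (hκ _ (tsupport_toCc_subset hK f)).trans ?_
  rw [mul_assoc]
  refine mul_le_mul_of_nonneg_left ?_ κ.2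
  have h1 : normL1 μ (toCc hK f) = ∫ t in K, ‖(f : G →ᵇ ℂ) t‖ ∂μ := by
    refine (setIntegral_eq_integral_of_forall_compl_eq_zero fun t ht => ?_).symm
    exact norm_eq_zero.2 (f.2 t ht)
  rw [h1, mul_comm]
  refine (le_abs_self _).trans ?_
  rw [← Real.norm_eq_abs]
  refine norm_setIntegral_le_of_norm_le_const (hK.measure_lt_top) fun t _ => ?_
  rw [norm_norm]
  exact (f : G →ᵇ ℂ).norm_coe_le_norm t

lemma LocallyBounded.continuous_comp (hθ : LocallyBounded μ θ) {K : Set G} (hK : IsCompact K)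
    {F : G → C_c(G, ℂ)} (hF : Continuous fun p : G × G => F p.1 p.2)
    (hFK : ∀ s, ∀ t ∉ K, F s t = 0) (hne : K.Nonempty) : Continuous fun s => θ (F s) := by
  obtain ⟨Φ, hΦ, hΦF⟩ := exists_continuous_lift hK hF hFK
  obtain ⟨T, hT⟩ := hθ.exists_continuousLinearMap hK hne
  simp only [← hΦF, ← hT]
  exact T.continuous.comp hΦ

/-- A locally bounded map commutes with integrals of compactly supported continuous families. -/
lemma LocallyBounded.map_integral [BorelSpace G] [CompleteSpace H] (hθ : LocallyBounded μ θ)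
    {K K' : Set G} (hK : IsCompact K) (hne : K.Nonempty) (hK' : IsCompact K') {F : G → C_c(G, ℂ)}
    (hF : Continuous fun p : G × G => F p.1 p.2) (hFK : ∀ s, ∀ t ∉ K, F s t = 0)
    (hFK' : ∀ s ∉ K', F s = 0) {h : C_c(G, ℂ)} (hh : ∀ t, h t = ∫ s, F s t ∂μ) :
    θ h = ∫ s, θ (F s) ∂μ := by
  obtain ⟨Φ, hΦ, hΦF⟩ := exists_continuous_lift hK hF hFK
  obtain ⟨T, hT⟩ := hθ.exists_continuousLinearMap hK hne
  have hinj : Function.Injective (toCc hK) := fun f g hfg => by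
    ext t
    exact DFunLike.congr_fun hfg t
  have hint : Integrable Φ μ := by
    refine hΦ.integrable_of_hasCompactSupport (HasCompactSupport.intro hK' fun s hs => hinj ?_)
    rw [hΦF, hFK' s hs, map_zero]
  have heval : toCc hK (∫ s, Φ s ∂μ) = h := by
    ext t
    let ev : vanishingOff K →L[ℂ] ℂ :=
      (BoundedContinuousFunction.evalCLM ℂ t).comp (vanishingOff K).subtypeL
    have h1 : toCc hK (∫ s, Φ s ∂μ) t = ev (∫ s, Φ s ∂μ) := rfl
    rw [h1, ← ev.integral_comp_comm hint, hh]
    refine integral_congr_ae (Filter.Eventually.of_forall fun s => ?_)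
    exact DFunLike.congr_fun (hΦF s) t
  rw [← heval, ← hT, ← T.integral_comp_comm hint]
  simp only [hT, hΦF]

end Interchange

variable {G : Type u} [Group G] [TopologicalSpace G] [IsTopologicalGroup G]

/-- The left translate `t ↦ g (s⁻¹ t)`. -/
noncomputable def leftTranslate (s : G) (g : C_c(G, ℂ)) : C_c(G, ℂ) where
  toFun t := g (s⁻¹ * t)
  continuous_toFun := by fun_prop
  hasCompactSupport' := g.hasCompactSupport.comp_homeomorph (Homeomorph.mulLeft s⁻¹)

lemma leftTranslate_apply (s t : G) (g : C_c(G, ℂ)) : leftTranslate s g t = g (s⁻¹ * t) := rfl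

lemma leftTranslate_mul (s t : G) (g : C_c(G, ℂ)) :
    leftTranslate (s * t) g = leftTranslate s (leftTranslate t g) := by
  ext x
  simp [leftTranslate_apply, mul_assoc]

/-- The functions `f s • leftTranslate s g` vanish off the compact set `tsupport f * tsupport g`;
the point `1` is added to make this set non-empty. -/
lemma smul_leftTranslate_eq_zero (f g : C_c(G, ℂ)) (s t : G)
    (ht : t ∉ insert 1 (tsupport f * tsupport g)) : (f s • leftTranslate s g) t = 0 := by
  by_contra hne
  have hne' : f s * g (s⁻¹ * t) ≠ 0 := hne
  refine ht (Set.mem_insert_of_mem _ (Set.mem_mul.2 ⟨s, ?_, s⁻¹ * t, ?_, by group⟩))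
  · exact subset_tsupport _ (left_ne_zero_of_mul hne')
  · exact subset_tsupport _ (right_ne_zero_of_mul hne')

lemma continuous_smul_leftTranslate (f g : C_c(G, ℂ)) :
    Continuous fun p : G × G => (f p.1 • leftTranslate p.1 g) p.2 := by
  change Continuous fun p : G × G => f p.1 * g (p.1⁻¹ * p.2)
  fun_prop

lemma isCompact_insert_mul_tsupport (f g : C_c(G, ℂ)) :
    IsCompact (insert 1 (tsupport f * tsupport g)) :=
  (f.hasCompactSupport.isCompact.mul g.hasCompactSupport.isCompact).insert 1

variable [MeasurableSpace G]

lemma augmentation_leftTranslate [BorelSpace G] {μ : Measure G} [μ.IsMulLeftInvariant] (s : G)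
    (g : C_c(G, ℂ)) :
    augmentation μ (leftTranslate s g) = augmentation μ g :=
  integral_mul_left_eq_self (fun t => g t) s⁻¹

lemma exists_augmentation_eq_one [BorelSpace G] [LocallyCompactSpace G] (μ : Measure G)
    [IsFiniteMeasureOnCompacts μ] [μ.IsOpenPosMeasure] : ∃ g : C_c(G, ℂ), augmentation μ g = 1 := by
  obtain ⟨φ, hφc, hφ1, -, hφ⟩ := exists_bump (G := G) isOpen_univ (isCompact_singleton (x := 1))
    (Set.subset_univ _)
  have hpos : 0 < ∫ t, φ t ∂μ := φ.continuous.integral_pos_of_hasCompactSupport_nonneg_nonzero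
    hφc hφ (x := 1) (by simp [hφ1])
  refine ⟨((∫ t, φ t ∂μ : ℝ) : ℂ)⁻¹ • complexOfReal φ hφc, ?_⟩
  have h1 : augmentation μ (complexOfReal φ hφc) = ((∫ t, φ t ∂μ : ℝ) : ℂ) := integral_ofReal
  have h2 : ∀ (c : ℂ) (f : C_c(G, ℂ)), augmentation μ (c • f) = c * augmentation μ f :=
    fun c f => integral_const_mul c _
  rw [h2, h1]
  exact inv_mul_cancel₀ (Complex.ofReal_ne_zero.2 hpos.ne')

variable [T2Space G] {H : Type*} [NormedAddCommGroup H] [InnerProductSpace ℂ H]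
  {μ : Measure G} [IsFiniteMeasureOnCompacts μ] {θ : C_c(G, ℂ) →ₗ[ℂ] H}

lemma LocallyBounded.continuous_leftTranslate [LocallyCompactSpace G]
    (hθ : LocallyBounded μ θ) (g : C_c(G, ℂ)) : Continuous fun s => θ (leftTranslate s g) := by
  refine continuous_iff_continuousAt.2 fun s₀ => ?_
  obtain ⟨K, hK, hKs⟩ := exists_compact_mem_nhds s₀
  -- A cutoff equal to `1` near `s₀` puts the supports of all translates in one compact set.
  obtain ⟨φ, hφc, hφ1, -, -⟩ := exists_bump isOpen_univ hK (Set.subset_univ _)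
  let f := complexOfReal φ hφc
  have h1 := hθ.continuous_comp (isCompact_insert_mul_tsupport f g)
    (continuous_smul_leftTranslate f g) (smul_leftTranslate_eq_zero f g) (Set.insert_nonempty _ _)
  refine h1.continuousAt.congr ?_
  filter_upwards [hKs] with s hs
  have h2 : f s = 1 := by
    change (φ s : ℂ) = 1
    rw [hφ1 s hs, Complex.ofReal_one]
  rw [h2, one_smul]

variable [BorelSpace G]

/-- Convolution is an integral of left translates, and a locally bounded map respects it. -/
lemma LocallyBounded.map_convol [CompleteSpace H] (hθ : LocallyBounded μ θ) (f g : C_c(G, ℂ)) :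
    θ (convol μ f g) = ∫ s, f s • θ (leftTranslate s g) ∂μ := by
  have h := hθ.map_integral (isCompact_insert_mul_tsupport f g) (Set.insert_nonempty _ _)
    f.hasCompactSupport.isCompact (continuous_smul_leftTranslate f g)
    (smul_leftTranslate_eq_zero f g) (fun s hs => by
      rw [image_eq_zero_of_notMem_tsupport hs, zero_smul]) (h := convol μ f g) fun t => rfl
  simpa only [map_smul] using h

variable [LocallyCompactSpace G]

/-- A locally bounded derivation is integration against a continuous cocycle, namely
`s ↦ θ (leftTranslate s g) - π s (θ g)` for any `g` of integral `1`. -/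
theorem LocallyBounded.exists_cocycle [CompleteSpace H] [μ.IsMulLeftInvariant]
    [μ.IsOpenPosMeasure] (hθ : LocallyBounded μ θ) {π : G →* (H ≃ₗᵢ[ℂ] H)}
    (hπ : NormContinuous π) (hd : IsDerivation μ π θ) :
    ∃ b : G → H, Continuous b ∧ IsCocycle π b ∧ ∀ f, θ f = ∫ t, f t • b t ∂μ := by
  let β : C_c(G, ℂ) → G → H := fun g s => θ (leftTranslate s g) - π s (θ g)
  have hβ : ∀ g, Continuous (β g) := fun g => (hθ.continuous_leftTranslate g).sub (hπ _)
  have hrep : ∀ g, augmentation μ g = 1 → ∀ f, θ f = ∫ t, f t • β g t ∂μ := by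
    intro g hg f
    have h1 := hd f g
    rw [hθ.map_convol, hg, one_smul, ← sub_eq_iff_eq_add', integratedForm,
      ← integral_sub (integrable_smul f (hθ.continuous_leftTranslate g))
        (integrable_smul f (hπ _))] at h1
    simpa only [← smul_sub] using h1.symm
  obtain ⟨g, hg⟩ := exists_augmentation_eq_one (G := G) μ
  refine ⟨β g, hβ g, fun s t => ?_, hrep g hg⟩
  -- Translating `g` does not change its integral, hence does not change the cocycle.
  have hgt : augmentation μ (leftTranslate t g) = 1 := (augmentation_leftTranslate t g).trans hg
  have heq : β (leftTranslate t g) s = β g s := by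
    have h1 := norm_le_of_norm_integral_smul_le (μ := μ) ((hβ (leftTranslate t g)).sub (hβ g))
      le_rfl (fun f => ?_) s
    · exact sub_eq_zero.1 (norm_le_zero_iff.1 h1)
    · simp only [Pi.sub_apply, smul_sub]
      rw [integral_sub (integrable_smul f (hβ _)) (integrable_smul f (hβ _)), ← hrep _ hgt,
        ← hrep _ hg, sub_self, norm_zero, zero_mul]
  rw [← heq]
  simp only [β, leftTranslate_mul, map_mul, LinearIsometryEquiv.coe_mul, Function.comp_apply,
    map_sub]
  abel

end CocycleOfDerivation

/-! ### Property (T) and bounded derivations -/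

section Main

variable {G : Type u} [Group G] [TopologicalSpace G] [MeasurableSpace G]

lemma ContinuouslyLocallyBounded.locallyBounded {H : Type*} [NormedAddCommGroup H]
    [InnerProductSpace ℂ H] {μ : Measure G} {θ : C_c(G, ℂ) →ₗ[ℂ] H}
    (hθ : ContinuouslyLocallyBounded μ θ) : LocallyBounded μ θ := by
  obtain ⟨κ, hκ, -⟩ := hθ
  exact fun K => ⟨κ K, hκ K⟩

variable [IsTopologicalGroup G] [LocallyCompactSpace G] [T2Space G] [BorelSpace G]

variable {μ : Measure G} [IsFiniteMeasureOnCompacts μ] [μ.IsMulLeftInvariant]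
  [μ.IsOpenPosMeasure]

theorem PropertyT.l1Bounded (hG : PropertyT.{u, v} G) {H : Type (max u v)} [NormedAddCommGroup H]
    [InnerProductSpace ℂ H] [CompleteSpace H] {π : G →* (H ≃ₗᵢ[ℂ] H)} (hπ : NormContinuous π)
    {θ : C_c(G, ℂ) →ₗ[ℂ] H} (hθ : LocallyBounded μ θ) (hd : IsDerivation μ π θ) :
    L1Bounded μ θ := by
  obtain ⟨b, hbc, hb, hθb⟩ := hθ.exists_cocycle hπ hd
  obtain ⟨C, hC⟩ := hG.isBounded_cocycle hπ hb hbc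
  refine ⟨C.toNNReal, fun f => ?_⟩
  rw [hθb]
  exact norm_integral_smul_le f fun t _ => (hC t).trans (Real.le_coe_toNNReal C)

theorem propertyT_of_l1Bounded [SigmaCompactSpace G]
    (h : ∀ (H : Type (max u v)) [NormedAddCommGroup H] [InnerProductSpace ℂ H] [CompleteSpace H]
      (π : G →* (H ≃ₗᵢ[ℂ] H)), NormContinuous π →
      ∀ θ : C_c(G, ℂ) →ₗ[ℂ] H, ContinuouslyLocallyBounded μ θ →
        IsDerivation μ π θ → L1Bounded μ θ) : PropertyT.{u, v} G := by
  refine propertyT_of_isBounded_cocycle fun H _ _ _ π hπ b hb hbc => ?_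
  obtain ⟨κ, hκ⟩ := h H π hπ (integrateAgainst μ hbc)
    (continuouslyLocallyBounded_integrateAgainst hbc hb.map_one)
    (isDerivation_integrateAgainst hπ hb hbc)
  exact ⟨κ, norm_le_of_norm_integral_smul_le hbc κ.2 hκ⟩

end Main

end PropertyTDerivation

theorem mainTheorem2 {G : Type u} [Group G] [TopologicalSpace G] [IsTopologicalGroup G]
    [LocallyCompactSpace G] [T2Space G] [MeasurableSpace G] [BorelSpace G]
    (μ : Measure G) [μ.IsHaarMeasure] [μ.Regular] :
    -- (a), for an arbitrary locally compact group
    (PropertyT.{u, v} G →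
      ∀ (H : Type (max u v)) [NormedAddCommGroup H] [InnerProductSpace ℂ H] [CompleteSpace H]
        (π : G →* (H ≃ₗᵢ[ℂ] H)), NormContinuous π →
        ∀ θ : C_c(G, ℂ) →ₗ[ℂ] H, ContinuouslyLocallyBounded μ θ →
          IsDerivation μ π θ → L1Bounded μ θ) ∧
    -- (a), for a second countable group
    (PropertyT.{u, v} G → SecondCountableTopology G →
      ∀ (H : Type (max u v)) [NormedAddCommGroup H] [InnerProductSpace ℂ H] [CompleteSpace H]
        (π : G →* (H ≃ₗᵢ[ℂ] H)), NormContinuous π →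
        ∀ θ : C_c(G, ℂ) →ₗ[ℂ] H, LocallyBounded μ θ →
          IsDerivation μ π θ → L1Bounded μ θ) ∧
    -- (b)
    (SigmaCompactSpace G →
      (∀ (H : Type (max u v)) [NormedAddCommGroup H] [InnerProductSpace ℂ H] [CompleteSpace H]
        (π : G →* (H ≃ₗᵢ[ℂ] H)), NormContinuous π →
        ∀ θ : C_c(G, ℂ) →ₗ[ℂ] H, ContinuouslyLocallyBounded μ θ →
          IsDerivation μ π θ → L1Bounded μ θ) →
      PropertyT.{u, v} G) := by
  refine ⟨fun hG H _ _ _ π hπ θ hθ hd => hG.l1Bounded hπ hθ.locallyBounded hd,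
    fun hG _ H _ _ _ π hπ θ hθ hd => hG.l1Bounded hπ hθ hd, fun _ h => propertyT_of_l1Bounded h⟩
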